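/- **Setting.** Let $I$ be a finite set of $N$ players, each owning exactly one of $N$ items. Nature draws $\theta\in\Theta$; player $i$ learns only her type, which determines her strict preference over items, represented by a payoff $u_i$ that depends only on her type and on the item she gets. The game has $T\ge N$ stages; at every stage all players simultaneously name an item. **Dynamic TTC game.** Given the items named at a stage, player $j$ points to player $k$ if $j$ names $k$'s item; the *repository* of $i$ consists of $i$'s own item and the items of all players who point to $i$ directly or through a chain of pointing players. A player who names an item in her repository leaves the game with (is assigned) that item. An item is *available* as long as it has not been assigned. A player is *asked* to name an item at stage 1, and at a later stage whenever she is still in the game and the item she named last has been assigned to someone else; she may then name any available item. At all other stages (while waiting, and after having left) she must repeat the item she named last. Before each stage every player observes the set of available items, but neither the repositories nor the items the others name; thus an information set of $i$ consists of her type, the history of sets of available items and her own past choices. Player $i$ is *active* at an information set if she is asked to name an item there (even if just one item is available). Her outcome is the item she names at stage $T$. **Local end-dominance.** A strategy $s_i$ of player $i$ selects an available action at every information set of $i$; a contingency $s_{-i}$ is a $\theta$ together with a strategy for every opponent; $\zeta(s_i,s_{-i})$ is the induced terminal history. For an information set $h$ of $i$ let $S_{-i}(h)$ be the set of contingencies that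 allow $h$ to be reached, and $S_i(h,a)$ the set of strategies of $i$ that allow $h$ to be reached and choose $a$ at $h$. Let $E(a)\subseteq S_{-i}(h)$ be the set of contingencies $s_{-i}$ such that, for all $s_i\in S_i(h,a)$, no active information set of $i$ occurs after $h$ along $\zeta(s_i,s_{-i})$. For actions $\bar a,a$ available at $h$, the *ending partition* consists of $$E(a)\cap E(\bar a),\quad E(a)\setminus E(\bar a),\quad E(\bar a)\setminus E(a),\quad S_{-i}(h)\setminus(E(\bar a)\cup E(a)).$$ Given a set $S\subseteq S_{-i}(h)$, a strategy $\bar s_i$ *mimics* $s_i$ given $h$ and $S$ if for every $s_{-i}\in S$ and every stage from the first active information set of $i$ after $h$ along $\zeta(\bar s_i,s_{-i})$ onwards, $\bar s_i$ prescribes along $\zeta(\bar s_i,s_{-i})$ the same action that $s_i$ prescribes along $\zeta(s_i,s_{-i})$ at that stage. The set $S$ is *irrelevant* for $(\bar a,a)$ if for every $s_i\in S_i(h,a)$ some $\bar s_i\in S_i(h,\bar a)$ mimics $s_i$ given $h$ and $S$ and gives $i$ the same outcome as $s_i$ under every $s_{-i}\in S$. Action $\bar a$ *locally end-dominates* $a$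 at $h$ if for every cell $S$ of the ending partition that is not irrelevant and every $s_i\in S_i(h,a)$ there is $\bar s_i\in S_i(h,\bar a)$ that mimics $s_i$ given $h$ and $S$ with $$\min_{s_{-i}\in S}u_i(\zeta(\bar s_i,s_{-i}))\ \ge\ \max_{s_{-i}\in S}u_i(\zeta(s_i,s_{-i})).$$ Action $\bar a$ is *locally end-dominant* at $h$ if it is available at $h$ and locally end-dominates every other action available at $h$. **Proposition 3.** In the dynamic TTC game, at every information set at which a player is active, naming her favourite available item is locally end-dominant. -/

import Mathlib

/-- A multistage game with asymmetric observation of an initial move of nature `θ : Θ`.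
A history is a pair `(θ, m)`, where `m` lists the action profiles of the past stages, the most
recent one first. `obs i x` is what player `i` observes at history `x`, just before the next stage;
`avail i x` is the set of actions available to her there. `active i x` says that she is called upon
to make a choice at `x`; wherever she is not, she has a single (dummy) action.
`outcome` is the outcome function, and `utility` represents preferences over `Θ × Out i`. -/
structure MultistageGame (I : Type*) (Θ : Type*) where
  horizon : ℕ
  Act : I → Type*
  Obs : I → Type*
  Out : I → Type*
  obs : ∀ i, Θ × List (∀ j, Act j) → Obs i
  avail : ∀ i, Θ × List (∀ j, Act j) → Set (Act i)
  active : ∀ i, Θ × List (∀ j, Act j) → Prop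
  outcome : ∀ i, Θ × List (∀ j, Act j) → Out i
  utility : ∀ i, Θ → Out i → ℝ
  avail_nonempty : ∀ i x, (avail i x).Nonempty
  subsingleton_of_not_active : ∀ i x, ¬ active i x → (avail i x).Subsingleton
  /-- Availability of actions and activity depend only on past and present observations and on
  own past actions, i.e. only on the information set. -/
  info_congr : ∀ i (x y : Θ × List (∀ j, Act j)),
    x.2.tails.map (fun m => obs i (x.1, m)) = y.2.tails.map (fun m => obs i (y.1, m)) →
    x.2.map (fun p => p i) = y.2.map (fun p => p i) →
    avail i x = avail i y ∧ (active i x ↔ active i y)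

namespace MultistageGame

variable {I Θ : Type*} (G : MultistageGame I Θ)

/-- Action profiles. -/
abbrev Profile := ∀ j, G.Act j

/-- Histories (most recent profile first). -/
abbrev Hist := Θ × List G.Profile

/-- Feasible sequences of action profiles after the move of nature `θ`. -/
inductive Feasible (θ : Θ) : List G.Profile → Prop
  | nil : Feasible θ []
  | cons (p : G.Profile) (m : List G.Profile) : Feasible θ m → m.length < G.horizon →
      (∀ i, p i ∈ G.avail i (θ, m)) → Feasible θ (p :: m)

/-- Feasible non-terminal histories. -/
def NonTerminal (x : G.Hist) : Prop := G.Feasible x.1 x.2 ∧ x.2.length < G.horizon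

/-- An information set of player `i` is identified with what `i` knows at it: all her
observations so far and all her own past actions (both listed most recent first). -/
structure Info (i : I) where
  seen : List (G.Obs i)
  own : List (G.Act i)

/-- The information set of player `i` that contains the history `x`: two histories lie in the same
information set exactly when `i` has made the same observations and taken the same actions. -/
def info (i : I) (x : G.Hist) : G.Info i where
  seen := x.2.tails.map (fun m => G.obs i (x.1, m))
  own := x.2.map (fun p => p i)

variable {G}

/-- The number of stages completed before the information set `h`; moves at `h` are moves of
stage `h.time + 1`. -/
def Info.time {i : I} (h : G.Info i) : ℕ := h.own.length

variable (G)

/-- The information sets of `i`. -/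
def infoSets (i : I) : Set (G.Info i) := {h | ∃ x, G.NonTerminal x ∧ G.info i x = h}

/-- The information sets where `i` is active. -/
def activeSets (i : I) : Set (G.Info i) :=
  {h | ∃ x, G.NonTerminal x ∧ G.info i x = h ∧ G.active i x}

variable {G}

/-- The actions available to `i` at the information set `h`. -/
def Info.actions {i : I} (h : G.Info i) : Set (G.Act i) :=
  {a | ∃ x, G.NonTerminal x ∧ G.info i x = h ∧ a ∈ G.avail i x}

variable (G)

/-- Strategies of player `i`: an available action at each information set. What is prescribed at
information sets excluded by the strategy's own earlier prescriptions plays no role in any of the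
notions below. -/
def Strategy (i : I) : Type _ :=
  {s : G.Info i → G.Act i // ∀ h ∈ G.infoSets i, s h ∈ h.actions}

/-- A contingency for player `i`: a move of nature and a strategy for every opponent. -/
abbrev Contingency (i : I) : Type _ := Θ × (∀ j : {j : I // j ≠ i}, G.Strategy j)

variable {G}

open Classical in
/-- The strategy profile made of a strategy of `i` and the strategies of the opponents. -/
noncomputable def join {i : I} (s : G.Strategy i) (c : G.Contingency i) : ∀ j, G.Strategy j :=
  fun j => if h : j = i then h ▸ s else c.2 ⟨j, h⟩

/-- The first `t` action profiles played under a strategy profile after the move of nature `θ`. -/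
def play (σ : ∀ j, G.Strategy j) (θ : Θ) : ℕ → List G.Profile
  | 0 => []
  | t + 1 => (fun j => (σ j).1 (G.info j (θ, play σ θ t))) :: play σ θ t

/-- The history reached after `t` stages under `(s, c)`. -/
noncomputable def path {i : I} (s : G.Strategy i) (c : G.Contingency i) (t : ℕ) : G.Hist :=
  (c.1, play (join s c) c.1 t)

/-- The information set of `i` reached after `t` stages under `(s, c)`. -/
noncomputable def infoAt {i : I} (s : G.Strategy i) (c : G.Contingency i) (t : ℕ) : G.Info i :=
  G.info i (path s c t)

/-- The terminal history induced by `(s, c)`. -/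
noncomputable def terminal {i : I} (s : G.Strategy i) (c : G.Contingency i) : G.Hist :=
  path s c G.horizon

/-- The outcome of `i` under `(s, c)`. -/
noncomputable def result {i : I} (s : G.Strategy i) (c : G.Contingency i) : G.Out i :=
  G.outcome i (terminal s c)

/-- The payoff of `i` under `(s, c)`. -/
noncomputable def payoff {i : I} (s : G.Strategy i) (c : G.Contingency i) : ℝ :=
  G.utility i c.1 (result s c)

/-- `(s, c)` reaches the information set `h`. -/
def Reaches {i : I} (s : G.Strategy i) (c : G.Contingency i) (h : G.Info i) : Prop :=
  ∃ t < G.horizon, infoAt s c t = h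

/-- The contingencies that allow to reach `h`. -/
def contingencies {i : I} (h : G.Info i) : Set (G.Contingency i) := {c | ∃ s, Reaches s c h}

/-- The strategies of `i` that allow to reach `h` and choose `a` there: the continuation plans
after `a`. -/
def plans {i : I} (h : G.Info i) (a : G.Act i) : Set (G.Strategy i) :=
  {s | (∃ c, Reaches s c h) ∧ s.1 h = a}

/-- The contingencies that terminate the game for `i` after choosing `a` at `h`: no active
information set of `i` is met after `h`. -/
def ending {i : I} (h : G.Info i) (a : G.Act i) : Set (G.Contingency i) :=
  {c | c ∈ contingencies h ∧ ∀ s ∈ plans h a, ∀ t, h.time < t → t < G.horizon →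
    infoAt s c t ∉ G.activeSets i}

/-- The ending partition for the comparison of `a'` and `a` at `h`. -/
def endingPartition {i : I} (h : G.Info i) (a' a : G.Act i) : Set (Set (G.Contingency i)) :=
  {ending h a ∩ ending h a', ending h a \ ending h a', ending h a' \ ending h a,
    contingencies h \ (ending h a' ∪ ending h a)}

/-- `s'` mimics `s` given `h` and the scenario `S`: under every contingency in `S`, from the first
active information set that `i` meets after `h` under `s'` onwards, `s'` prescribes on its path the
same action as `s` prescribes on its own path at the same stage. (A stage `t` comes weakly after
that first active information set iff some active information set is met at a stage `t₀ ≤ t` after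
`h`.) -/
def Mimics {i : I} (s' s : G.Strategy i) (h : G.Info i) (S : Set (G.Contingency i)) : Prop :=
  ∀ c ∈ S, ∀ t₀ t, h.time < t₀ → t₀ ≤ t → t < G.horizon → infoAt s' c t₀ ∈ G.activeSets i →
    s'.1 (infoAt s' c t) = s.1 (infoAt s c t)

/-- The scenario `S` is irrelevant for the ordered pair `(a', a)` at `h`. -/
def Irrelevant {i : I} (h : G.Info i) (a' a : G.Act i) (S : Set (G.Contingency i)) : Prop :=
  ∀ s ∈ plans h a, ∃ s' ∈ plans h a', Mimics s' s h S ∧ ∀ c ∈ S, result s' c = result s c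

/-- Action `a'` locally end-dominates action `a` at `h`: for every relevant scenario of the ending
partition and every continuation plan after `a` there is a mimicking continuation plan after `a'`
whose worst payoff in the scenario is at least the best payoff of the plan after `a`. -/
def EndDominates {i : I} (h : G.Info i) (a' a : G.Act i) : Prop :=
  ∀ S ∈ endingPartition h a' a, ¬ Irrelevant h a' a S →
    ∀ s ∈ plans h a, ∃ s' ∈ plans h a', Mimics s' s h S ∧
      ∀ c' ∈ S, ∀ c ∈ S, payoff s c ≤ payoff s' c'

/-- Action `a'` is locally end-dominant at `h`. -/
def LocallyEndDominant {i : I} (h : G.Info i) (a' : G.Act i) : Prop :=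
  a' ∈ h.actions ∧ ∀ a ∈ h.actions, a ≠ a' → EndDominates h a' a

end MultistageGame

namespace TTC

variable {I O : Type*} (own : I ≃ O)

/-- `j` points to `k` when `j` names the item owned by `k`. -/
def Points (p : I → O) (j k : I) : Prop := p j = own k

/-- The "you name it, you get it" repository of `i` when `p` is the profile of named items: the own
item, and the items of the players who directly or indirectly point to `i`. -/
def repository (p : I → O) (i : I) : Set O :=
  {own i} ∪ {x | Relation.TransGen (Points own p) (own.symm x) i}

/-- Player `i` has left the game: the item she named last is in her repository. -/
def HasLeft (i : I) : List (I → O) → Prop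
  | [] => False
  | p :: _ => p i ∈ repository own p i

/-- The item `x` has been assigned to `j`: `j` left the game naming `x`. -/
def AssignedTo (x : O) (j : I) : List (I → O) → Prop
  | [] => False
  | p :: m => HasLeft own j (p :: m) ∧ p j = x

/-- The set of still available items. -/
def available (m : List (I → O)) : Set O := {x | ∀ j, ¬ AssignedTo own x j m}

/-- Player `i` is asked to name an item: at the first stage, and whenever she is still in the game
but the item she named last is no longer available. -/
def Asked (i : I) : List (I → O) → Prop
  | [] => True
  | p :: m => ¬ HasLeft own i (p :: m) ∧ p i ∉ available own (p :: m)

/-- The item that `i` named last (before the first stage, conventionally her own). -/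
def lastNamed (i : I) : List (I → O) → O
  | [] => own i
  | p :: _ => p i

/-- The items that `i` may name: any available item if she is asked to name one; otherwise she has
to repeat the item she named last. -/
def menu (i : I) (m : List (I → O)) : Set O :=
  {x | (Asked own i m ∧ x ∈ available own m) ∨ (¬ Asked own i m ∧ x = lastNamed own i m)}

theorem hasLeft_iff (i : I) (p : I → O) (m : List (I → O)) :
    HasLeft own i (p :: m) ↔ Relation.TransGen (Points own p) i i := by
  have hp : Points own p i (own.symm (p i)) := by simp [Points]
  constructor
  · rintro (h | h)
    · exact .single h
    · exact .head hp h
  · intro h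
    obtain ⟨k, hk, hki⟩ := Relation.TransGen.head'_iff.1 h
    have hk' : own.symm (p i) = k := by rw [show p i = own k from hk]; simp
    rcases Relation.reflTransGen_iff_eq_or_transGen.1 hki with h1 | h1
    · left
      subst h1
      exact hk
    · right
      simpa [hk'] using h1

/-- A player is in the game exactly as long as her own item is available. -/
theorem own_mem_available_iff (i : I) (m : List (I → O)) :
    own i ∈ available own m ↔ ¬ HasLeft own i m := by
  cases m with
  | nil => simp [available, AssignedTo, HasLeft]
  | cons p m =>
    constructor
    · intro h hl
      obtain ⟨k, hik, hki⟩ := Relation.TransGen.tail'_iff.1 ((hasLeft_iff own i p m).1 hl)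
      exact h k ⟨(hasLeft_iff own k p m).2 (Relation.TransGen.head' hki hik), hki⟩
    · rintro h j ⟨hj, hji⟩
      obtain ⟨k, hk, hkj⟩ := Relation.TransGen.head'_iff.1 ((hasLeft_iff own j p m).1 hj)
      have hik : k = i := own.injective ((show p j = own k from hk).symm.trans hji)
      subst hik
      exact h ((hasLeft_iff own k p m).2 (Relation.TransGen.tail' hkj hk))

/-- Whether a player is asked to name an item can be read off the last set of available items and
the item she named last. -/
theorem asked_cons_iff (i : I) (p : I → O) (m : List (I → O)) :
    Asked own i (p :: m) ↔
      own i ∈ available own (p :: m) ∧ p i ∉ available own (p :: m) := by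
  rw [own_mem_available_iff]; rfl

theorem asked_congr (i : I) (m m' : List (I → O)) (h : available own m = available own m')
    (h' : m.map (fun p => p i) = m'.map (fun p => p i)) :
    (Asked own i m ↔ Asked own i m') ∧ lastNamed own i m = lastNamed own i m' := by
  cases m with
  | nil =>
    cases m' with
    | nil => simp
    | cons p' m' => simp at h'
  | cons p m =>
    cases m' with
    | nil => simp at h'
    | cons p' m' =>
      simp only [List.map_cons, List.cons.injEq] at h'
      rw [asked_cons_iff, asked_cons_iff, h, h'.1]
      exact ⟨Iff.rfl, h'.1⟩

/-- The dynamic Top Trading Cycles game with `T` stages. Nature draws `θ`; player `i` learns her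
type `typ i θ`, and her payoff from getting item `x` is `v i (typ i θ) x`. At every stage players
observe the set of available items, but neither the repositories nor what the others name.
A player is active when she is asked to name an item. She ends up with the item she names at the
last stage. -/
def game {Θ : Type*} {Typ : I → Type*} (T : ℕ) (typ : ∀ i, Θ → Typ i)
    (v : ∀ i, Typ i → O → ℝ) : MultistageGame I Θ where
  horizon := T
  Act := fun _ => O
  Obs := fun i => Typ i × Set O
  Out := fun _ => O
  obs := fun i x => (typ i x.1, available own x.2)
  avail := fun i x => menu own i x.2
  active := fun i x => Asked own i x.2
  outcome := fun i x => lastNamed own i x.2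
  utility := fun i θ y => v i (typ i θ) y
  avail_nonempty := by
    rintro i ⟨θ, m⟩
    by_cases h : Asked own i m
    · refine ⟨own i, Or.inl ⟨h, ?_⟩⟩
      cases m with
      | nil => simp [available, AssignedTo]
      | cons p m => exact ((asked_cons_iff own i p m).1 h).1
    · exact ⟨lastNamed own i m, Or.inr ⟨h, rfl⟩⟩
  subsingleton_of_not_active := by
    rintro i ⟨θ, m⟩ h x hx y hy
    rcases hx with hx | hx
    · exact absurd hx.1 h
    · rcases hy with hy | hy
      · exact absurd hy.1 h
      · exact hx.2.trans hy.2.symm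
  info_congr := by
    rintro i ⟨θ, m⟩ ⟨θ', m'⟩ h h'
    have ha : available own m = available own m' := by
      have := congrArg (fun l => l.head?.map Prod.snd) h
      cases m <;> cases m' <;> simpa using this
    have hc := asked_congr own i m m' ha h'
    refine ⟨?_, hc.1⟩
    simp only [menu, ha, hc.1, hc.2]

end TTC

/-! Compare the favourite item `a` with another item `b` at `h`. On a cell inside `ending h a`,
every plan after `a` yields `a`, while a plan after `b` can only yield an item still available at
`h`; hence `a` does at least as well. Every other cell is disjoint from `ending h a` and turns out
to be irrelevant.

For irrelevance, a plan `s` after `b` is imitated by `shadowStrategy`, which names `a` at `h` and,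
once asked again, names what `s` would name by then. As long as `i` lies on no pointing cycle, her
own choice affects neither the set of available items nor, therefore, what the opponents see. So the
two runs look alike until she leaves in one of them. If she leaves under `s` with `y`, a chain of
opponents leads from the owner of `y` to her. It does not involve her own move, so it also exists in
the shadow run, and it persists there while she is in the game. When asked again, she names `y` and
gets it at once. If she has not left under `s` by then, the two runs agree from that stage on.

The dichotomy is `sameView_or_secured`; `naming_shadowStrategy_eq` draws the conclusion.
Contingencies outside `ending h a` guarantee that she is asked again
(`exists_active_of_not_mem_ending`). -/

namespace MultistageGame

/-! ### Induced paths and perfect recall in multistage games. -/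

variable {I Θ : Type*} {G : MultistageGame I Θ} {i : I}

/-- The action profile played under `(s, c)` after `t` stages. -/
noncomputable def moves (s : G.Strategy i) (c : G.Contingency i) (t : ℕ) : G.Profile :=
  fun j => (join s c j).1 (G.info j (path s c t))

theorem path_succ (s : G.Strategy i) (c : G.Contingency i) (t : ℕ) :
    path s c (t + 1) = (c.1, moves s c t :: (path s c t).2) := rfl

theorem moves_self (s : G.Strategy i) (c : G.Contingency i) (t : ℕ) :
    moves s c t i = s.1 (infoAt s c t) := by
  simp [moves, join, infoAt]

theorem moves_of_ne (s : G.Strategy i) (c : G.Contingency i) (t : ℕ) {j : I} (hj : j ≠ i) :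
    moves s c t j = (c.2 ⟨j, hj⟩).1 (G.info j (path s c t)) := by
  simp [moves, join, hj]

theorem info_path_succ (s : G.Strategy i) (c : G.Contingency i) (t : ℕ) (j : I) :
    G.info j (path s c (t + 1)) =
      ⟨G.obs j (path s c (t + 1)) :: (G.info j (path s c t)).seen,
        moves s c t j :: (G.info j (path s c t)).own⟩ := by
  simp only [info, path_succ, List.tails_cons, List.map_cons]
  rfl

theorem length_path (s : G.Strategy i) (c : G.Contingency i) (t : ℕ) :
    (path s c t).2.length = t := by
  induction t with
  | zero => rfl
  | succ t ih => rw [path_succ]; simp [ih]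

theorem time_infoAt (s : G.Strategy i) (c : G.Contingency i) (t : ℕ) :
    (infoAt s c t).time = t := by
  simp [Info.time, infoAt, info, length_path]

theorem avail_congr {j : I} {x y : G.Hist} (h : G.info j x = G.info j y) :
    G.avail j x = G.avail j y ∧ (G.active j x ↔ G.active j y) :=
  G.info_congr j x y (congrArg Info.seen h) (congrArg Info.own h)

theorem strategy_mem_avail {j : I} (σ : G.Strategy j) {x : G.Hist} (hx : G.NonTerminal x) :
    σ.1 (G.info j x) ∈ G.avail j x := by
  obtain ⟨y, -, hy, hm⟩ := σ.2 (G.info j x) ⟨x, hx, rfl⟩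
  rwa [(avail_congr hy).1] at hm

theorem feasible_path (s : G.Strategy i) (c : G.Contingency i) {t : ℕ} (ht : t ≤ G.horizon) :
    G.Feasible c.1 (path s c t).2 := by
  induction t with
  | zero => exact .nil
  | succ t ih =>
    have hf := ih (Nat.le_of_succ_le ht)
    have hl : (path s c t).2.length < G.horizon := by rw [length_path]; exact ht
    exact .cons _ _ hf hl fun j => strategy_mem_avail _ ⟨hf, hl⟩

theorem nonTerminal_path (s : G.Strategy i) (c : G.Contingency i) {t : ℕ} (ht : t < G.horizon) :
    G.NonTerminal (path s c t) :=
  ⟨feasible_path s c ht.le, by rwa [length_path]⟩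

theorem moves_mem_avail (s : G.Strategy i) (c : G.Contingency i) {t : ℕ} (ht : t < G.horizon)
    (j : I) : moves s c t j ∈ G.avail j (path s c t) :=
  strategy_mem_avail _ (nonTerminal_path s c ht)

theorem infoAt_mem_activeSets_iff (s : G.Strategy i) (c : G.Contingency i) {t : ℕ}
    (ht : t < G.horizon) : infoAt s c t ∈ G.activeSets i ↔ G.active i (path s c t) := by
  constructor
  · rintro ⟨x, -, hx, ha⟩
    exact (avail_congr hx).2.1 ha
  · exact fun h => ⟨_, nonTerminal_path s c ht, rfl, h⟩

/-- Two strategies with the same moves under `c` before stage `t` induce the same history. -/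
theorem path_congr {s s' : G.Strategy i} {c : G.Contingency i} {t : ℕ}
    (h : ∀ k < t, path s c k = path s' c k → s.1 (infoAt s c k) = s'.1 (infoAt s c k)) :
    path s c t = path s' c t := by
  induction t with
  | zero => rfl
  | succ t ih =>
    have hp := ih fun k hk => h k (hk.trans t.lt_succ_self)
    have hm : moves s c t = moves s' c t := by
      funext j
      by_cases hj : j = i
      · subst hj
        rw [moves_self, moves_self, h t t.lt_succ_self hp, infoAt, hp, infoAt]
      · rw [moves_of_ne s c t hj, moves_of_ne s' c t hj, hp]
    rw [path_succ, path_succ, hm, hp]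

theorem infoAt_eq_of_succ {s s' : G.Strategy i} {c c' : G.Contingency i} {t : ℕ}
    (h : infoAt s c (t + 1) = infoAt s' c' (t + 1)) :
    infoAt s c t = infoAt s' c' t ∧ s.1 (infoAt s c t) = s'.1 (infoAt s' c' t) := by
  simp only [infoAt, info_path_succ, moves_self, Info.mk.injEq, List.cons.injEq] at h
  refine ⟨?_, h.2.1⟩
  have h1 := h.1.2
  have h2 := h.2.2
  unfold infoAt
  generalize G.info i (path s c t) = x at *
  generalize G.info i (path s' c' t) = y at *
  cases x; cases y
  simp_all

/-- An information set records all earlier information sets and own moves, so `s` and `s'` agree at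
each of those met before it. Against `c'`, `s` therefore retraces the path of `s'`, although it was
`c` that led `s` to this information set. -/
theorem path_eq_of_infoAt_eq {s s' : G.Strategy i} {c c' : G.Contingency i} {t : ℕ}
    (h : infoAt s c t = infoAt s' c' t) : path s c' t = path s' c' t := by
  induction t with
  | zero => rfl
  | succ t ih =>
    obtain ⟨h1, h2⟩ := infoAt_eq_of_succ h
    have hp := ih h1
    have hm : moves s c' t = moves s' c' t := by
      funext j
      by_cases hj : j = i
      · subst hj
        rw [moves_self, moves_self, ← h2, h1, infoAt, hp, infoAt]
      · rw [moves_of_ne s c' t hj, moves_of_ne s' c' t hj, hp]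
    rw [path_succ, path_succ, hm, hp]

theorem Reaches.infoAt_time {s : G.Strategy i} {c : G.Contingency i} {h : G.Info i}
    (hr : Reaches s c h) : h.time < G.horizon ∧ infoAt s c h.time = h := by
  obtain ⟨t, ht, rfl⟩ := hr
  rw [time_infoAt]
  exact ⟨ht, rfl⟩

/-- Perfect recall: a strategy and a contingency that both allow `h` reach it together. -/
theorem infoAt_time_of_mem {s : G.Strategy i} {c : G.Contingency i} {h : G.Info i} {a : G.Act i}
    (hs : s ∈ plans h a) (hc : c ∈ contingencies h) :
    h.time < G.horizon ∧ infoAt s c h.time = h := by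
  obtain ⟨⟨c', hc'⟩, -⟩ := hs
  obtain ⟨s', hs'⟩ := hc
  have h1 := hc'.infoAt_time
  have h2 := hs'.infoAt_time
  refine ⟨h1.1, ?_⟩
  have := path_eq_of_infoAt_eq (h1.2.trans h2.2.symm)
  rw [infoAt, this]
  exact h2.2

theorem path_time_eq {s s' : G.Strategy i} {c : G.Contingency i} {h : G.Info i} {a a' : G.Act i}
    (hs : s ∈ plans h a) (hs' : s' ∈ plans h a') (hc : c ∈ contingencies h) :
    path s c h.time = path s' c h.time :=
  path_eq_of_infoAt_eq ((infoAt_time_of_mem hs hc).2.trans (infoAt_time_of_mem hs' hc).2.symm)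

/-- Outside `ending h a`, every plan after `a` meets an active information set after `h`. -/
theorem exists_active_of_not_mem_ending {s : G.Strategy i} {c : G.Contingency i} {h : G.Info i}
    {a : G.Act i} (hs : s ∈ plans h a) (hc : c ∈ contingencies h) (he : c ∉ ending h a) :
    ∃ t, h.time < t ∧ t < G.horizon ∧ G.active i (path s c t) := by
  by_contra! hno
  apply he
  refine ⟨hc, fun s' hs' t ht htT => ?_⟩
  rw [infoAt_mem_activeSets_iff s' c htT]
  -- While `s` meets no active information set, `i` has a single action at each stage after `h`, so
  -- all plans after `a` follow one path.
  suffices hp : path s c t = path s' c t by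
    rw [← hp]; exact hno t ht htT
  have h0 := path_time_eq hs hs' hc
  induction t, ht.le using Nat.le_induction with
  | base => exact h0
  | succ t hle ih =>
    have htT' : t < G.horizon := (Nat.lt_succ_self t).trans htT
    have hp : path s c t = path s' c t := by
      rcases hle.eq_or_lt with rfl | hlt
      · exact h0
      · exact ih hlt htT'
    have hm : moves s c t = moves s' c t := by
      funext j
      by_cases hj : j = i
      · subst hj
        rcases hle.eq_or_lt with rfl | hlt
        · rw [moves_self, moves_self, (infoAt_time_of_mem hs hc).2,
            (infoAt_time_of_mem hs' hc).2, hs.2, hs'.2]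
        · refine G.subsingleton_of_not_active j _ (hno t hlt htT') (moves_mem_avail s c htT' j) ?_
          rw [hp]; exact moves_mem_avail s' c htT' j
      · rw [moves_of_ne s c t hj, moves_of_ne s' c t hj, hp]
    rw [path_succ, path_succ, hm, hp]

theorem obs_eq_of_info_eq {x y : G.Hist} (h : G.info i x = G.info i y) :
    G.obs i x = G.obs i y := by
  have h1 := congrArg (fun z : G.Info i => z.seen.head?) h
  obtain ⟨θ, m⟩ := x
  obtain ⟨θ', m'⟩ := y
  cases m <;> cases m' <;> simpa [info] using h1

end MultistageGame

/-! ### The pointing graph: persistence of cycles and chains. -/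

namespace TTC

open Relation

variable {I O : Type*} {own : I ≃ O}

theorem points_unique {p : I → O} {j k l : I} (h : Points own p j k) (h' : Points own p j l) :
    k = l := own.injective (h.symm.trans h')

theorem mem_available_iff (x : O) (m : List (I → O)) :
    x ∈ available own m ↔ ¬ HasLeft own (own.symm x) m := by
  simpa using own_mem_available_iff own (own.symm x) m

/-- Cycles persist when all their members repeat what they named. -/
theorem transGen_self_congr {p q : I → O} (h : ∀ k, TransGen (Points own p) k k → q k = p k)
    {j : I} (hj : TransGen (Points own p) j j) : TransGen (Points own q) j j := by
  -- The way back from `x` to `j` is carried along so that every vertex met lies on a cycle, where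
  -- `h` applies.
  suffices ∀ x, TransGen (Points own p) j x → ReflTransGen (Points own p) x j →
      TransGen (Points own q) j x from this j hj .refl
  intro x hx
  induction hx with
  | single hjx =>
    intro _
    exact .single ((h j hj).trans hjx)
  | @tail y z hy hyz ih =>
    intro hzj
    have hyj : TransGen (Points own p) y j := TransGen.head' hyz hzj
    exact (ih hyj.to_reflTransGen).tail ((h y (hyj.trans hy)).trans hyz)

/-- Chains leading to `i` persist when their members other than `i` repeat what they named. -/
theorem reflTransGen_congr {p q : I → O} {i j : I}
    (h : ∀ k, ReflTransGen (Points own p) k i → k ≠ i → q k = p k)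
    (hj : ReflTransGen (Points own p) j i) : ReflTransGen (Points own q) j i := by
  induction hj using ReflTransGen.head_induction_on with
  | refl => exact .refl
  | @head x z hxz hz ih =>
    -- The chain is cut at its first visit to `i`, so her own move never matters.
    by_cases hx : x = i
    · subst hx; exact .refl
    · exact .head ((h x (.head hxz hz) hx).trans hxz) ih

/-- Each player points to only one other, so a chain starting on a cycle cannot get off it. -/
theorem transGen_self_of_reflTransGen {p : I → O} {k i : I}
    (hki : ReflTransGen (Points own p) k i) (hk : TransGen (Points own p) k k) :
    TransGen (Points own p) i i := by
  induction hki with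
  | refl => exact hk
  | @tail x y _ hxy ih =>
    obtain ⟨z, hxz, hzx⟩ := TransGen.head'_iff.1 ih
    obtain rfl := points_unique hxy hxz
    exact TransGen.tail' hzx hxy

/-- Splits a cycle through `i` into her own move and a chain back to her; the chain is the part that
survives a change of her move. -/
theorem hasLeft_cons_iff_reflTransGen (i : I) (p : I → O) (m : List (I → O)) :
    HasLeft own i (p :: m) ↔ ReflTransGen (Points own p) (own.symm (p i)) i := by
  have hp : Points own p i (own.symm (p i)) := by simp [Points]
  rw [hasLeft_iff, TransGen.head'_iff]
  constructor
  · rintro ⟨k, hk, hki⟩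
    rwa [← points_unique hk hp]
  · exact fun h => ⟨_, hp, h⟩

theorem eq_lastNamed_of_not_asked {i : I} {m : List (I → O)} {x : O} (h : ¬ Asked own i m)
    (hx : x ∈ menu own i m) : x = lastNamed own i m := by
  rcases hx with hx | hx
  · exact absurd hx.1 h
  · exact hx.2

theorem HasLeft.not_asked {i : I} {m : List (I → O)} (h : HasLeft own i m) : ¬ Asked own i m := by
  cases m with
  | nil => exact h.elim
  | cons p m => exact fun ha => ha.1 h

theorem HasLeft.cons {j : I} {m : List (I → O)} {q : I → O} (h : HasLeft own j m)
    (hq : ∀ k, q k ∈ menu own k m) : HasLeft own j (q :: m) := by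
  cases m with
  | nil => exact h.elim
  | cons p m =>
    rw [hasLeft_iff] at h ⊢
    exact transGen_self_congr (fun k hk =>
      eq_lastNamed_of_not_asked ((hasLeft_iff own k p m).2 hk).not_asked (hq k)) h

theorem mem_available_of_mem_menu {i : I} {m : List (I → O)} {x : O} (hi : ¬ HasLeft own i m)
    (hx : x ∈ menu own i m) : x ∈ available own m := by
  by_cases h : Asked own i m
  · rcases hx with hx | hx
    · exact hx.2
    · exact absurd h hx.1
  · rw [eq_lastNamed_of_not_asked h hx]
    cases m with
    | nil => exact absurd trivial h
    | cons p m => exact not_not.1 fun hn => h ⟨hi, hn⟩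

/-- As long as `i` is in the game, the players pointing to her through a chain keep waiting. -/
theorem reflTransGen_cons {i j : I} {p q : I → O} {m : List (I → O)}
    (hi : ¬ HasLeft own i (p :: m)) (hq : ∀ k, q k ∈ menu own k (p :: m))
    (hj : ReflTransGen (Points own p) j i) : ReflTransGen (Points own q) j i := by
  -- If the item named by `k` were gone, its owner, the next player on the chain, would lie on a
  -- cycle, and so would `i`, who would have left.
  refine reflTransGen_congr (fun k hk hne =>
    eq_lastNamed_of_not_asked (fun ha : Asked own k (p :: m) => ha.2 ?_) (hq k)) hj
  rw [mem_available_iff, hasLeft_iff]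
  intro hcyc
  have hp : Points own p k (own.symm (p k)) := by simp [Points]
  rcases ReflTransGen.cases_head hk with h | ⟨z, hkz, hz⟩
  · exact hne h
  · obtain rfl := points_unique hkz hp
    exact hi ((hasLeft_iff own i p m).2 (transGen_self_of_reflTransGen hz hcyc))

theorem mem_available_of_reflTransGen {i : I} {p : I → O} {m : List (I → O)} {y : O}
    (hi : ¬ HasLeft own i (p :: m)) (hy : ReflTransGen (Points own p) (own.symm y) i) :
    y ∈ available own (p :: m) := by
  rw [mem_available_iff, hasLeft_iff]
  rw [hasLeft_iff] at hi
  exact fun h => hi (transGen_self_of_reflTransGen hy h)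

/-- The assigned items are those owned by members of cycles. No cycle contains `i`, so all cycles
are made of moves common to `p` and `q`. -/
theorem available_congr {i : I} {p q : I → O} {m m' : List (I → O)}
    (hpq : ∀ j ≠ i, p j = q j) (hp : ¬ HasLeft own i (p :: m)) (hq : ¬ HasLeft own i (q :: m')) :
    available own (p :: m) = available own (q :: m') := by
  rw [hasLeft_iff] at hp hq
  ext x
  rw [mem_available_iff, mem_available_iff, hasLeft_iff, hasLeft_iff, not_iff_not]
  constructor
  · refine transGen_self_congr fun k hk => (hpq k ?_).symm
    rintro rfl; exact hp hk
  · refine transGen_self_congr fun k hk => hpq k ?_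
    rintro rfl; exact hq hk

end TTC

/-! ### Runs of the dynamic game: monotonicity and outcomes. -/

namespace TTC

open Relation MultistageGame

variable {I O Θ : Type*} {own : I ≃ O} {Typ : I → Type*} {typ : ∀ i, Θ → Typ i}
  {v : ∀ i, Typ i → O → ℝ} {T : ℕ} {i : I}

/-- The sequence of profiles of named items after `t` stages under `(s, c)`. -/
noncomputable def named (s : (game own T typ v).Strategy i) (c : (game own T typ v).Contingency i)
    (t : ℕ) : List (I → O) := (path s c t).2

/-- The profile of items named under `(s, c)` after `t` stages. -/
noncomputable def naming (s : (game own T typ v).Strategy i) (c : (game own T typ v).Contingency i)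
    (t : ℕ) : I → O := moves s c t

section Run

variable (s s' : (game own T typ v).Strategy i) (c : (game own T typ v).Contingency i)

theorem named_succ (t : ℕ) : named s c (t + 1) = naming s c t :: named s c t := rfl

theorem naming_self (t : ℕ) : naming s c t i = s.1 (infoAt s c t) := moves_self s c t

theorem naming_mem_menu {t : ℕ} (ht : t < T) (j : I) : naming s c t j ∈ menu own j (named s c t) :=
  moves_mem_avail s c ht j

theorem infoAt_mem_activeSets_iff_asked {t : ℕ} (ht : t < T) :
    infoAt s c t ∈ (game own T typ v).activeSets i ↔ Asked own i (named s c t) :=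
  infoAt_mem_activeSets_iff s c ht

theorem seen_infoAt_succ (t : ℕ) : (infoAt s c (t + 1)).seen =
    (typ i c.1, available own (named s c (t + 1))) :: (infoAt s c t).seen :=
  congrArg Info.seen (info_path_succ s c t i)

theorem own_infoAt_succ (t : ℕ) : (infoAt s c (t + 1)).own =
    naming s c t i :: (infoAt s c t).own :=
  congrArg Info.own (info_path_succ s c t i)

theorem seen_infoAt (t : ℕ) : ∃ l, (infoAt s c t).seen =
    (typ i c.1, available own (named s c t)) :: l := by
  cases t with
  | zero => exact ⟨[], rfl⟩
  | succ t => exact ⟨_, seen_infoAt_succ s c t⟩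

variable {s s' c}

theorem hasLeft_named_mono {j : I} {t u : ℕ} (htu : t ≤ u) (hu : u ≤ T)
    (h : HasLeft own j (named s c t)) : HasLeft own j (named s c u) := by
  induction u, htu using Nat.le_induction with
  | base => exact h
  | succ u _ ih => exact (ih (Nat.le_of_succ_le hu)).cons (naming_mem_menu s c hu)

theorem available_named_anti {t u : ℕ} (htu : t ≤ u) (hu : u ≤ T) :
    available own (named s c u) ⊆ available own (named s c t) := by
  intro x hx
  rw [mem_available_iff] at hx ⊢
  exact fun h => hx (hasLeft_named_mono htu hu h)

/-- Whatever `i` names once she has been asked was available when she was asked. -/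
theorem naming_mem_available {t u : ℕ} (ha : Asked own i (named s c t)) (htu : t ≤ u) (hu : u < T) :
    naming s c u i ∈ available own (named s c t) := by
  induction u, htu using Nat.le_induction with
  | base => exact mem_available_of_mem_menu (fun h => h.not_asked ha) (naming_mem_menu s c hu i)
  | succ u htu ih =>
    rcases naming_mem_menu s c hu i with h | h
    · exact available_named_anti (htu.trans u.le_succ) hu.le h.2
    · rw [h.2]; exact ih (Nat.lt_of_succ_lt hu)

/-- A player who has left keeps naming her item. -/
theorem naming_of_hasLeft {t u : ℕ} (hl : HasLeft own i (named s c t)) (htu : t ≤ u) (hu : u < T) :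
    naming s c u i = lastNamed own i (named s c t) := by
  induction u, htu using Nat.le_induction with
  | base => exact eq_lastNamed_of_not_asked hl.not_asked (naming_mem_menu s c hu i)
  | succ u htu ih =>
    rw [← ih (Nat.lt_of_succ_lt hu)]
    exact eq_lastNamed_of_not_asked (hasLeft_named_mono (htu.trans u.le_succ) hu.le hl).not_asked
      (naming_mem_menu s c hu i)

theorem result_eq_naming {t : ℕ} (ht : t + 1 = T) : result s c = naming s c t i := by
  subst ht; rfl

/-- If no active information set follows `h`, then `i` ends up with the item she names at `h`. -/
theorem result_of_mem_ending {h : (game own T typ v).Info i} {a : O} (hs : s ∈ plans h a)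
    (hc : c ∈ ending h a) : result s c = a := by
  obtain ⟨hT, hh⟩ := infoAt_time_of_mem hs hc.1
  have key : ∀ t, h.time ≤ t → t < T → naming s c t i = a := by
    intro t ht
    induction t, ht using Nat.le_induction with
    | base =>
      intro _
      rw [naming_self, hh]; exact hs.2
    | succ t ht ih =>
      intro htT
      rw [← ih (Nat.lt_of_succ_lt htT)]
      refine eq_lastNamed_of_not_asked ?_ (naming_mem_menu s c htT i)
      rw [← infoAt_mem_activeSets_iff_asked s c htT]
      exact hc.2 s hs _ (Nat.lt_succ_of_le ht) htT
  have hT' : h.time < T := hT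
  obtain ⟨t, rfl⟩ : ∃ t, T = t + 1 := ⟨T - 1, by omega⟩
  rw [result_eq_naming rfl]
  exact key t (by omega) (by omega)

theorem result_mem_available {h : (game own T typ v).Info i} {a : O} (hs : s ∈ plans h a)
    (hc : c ∈ contingencies h) (ha : Asked own i (named s c h.time)) :
    result s c ∈ available own (named s c h.time) := by
  have hT' : h.time < T := (infoAt_time_of_mem hs hc).1
  obtain ⟨t, rfl⟩ : ∃ t, T = t + 1 := ⟨T - 1, by omega⟩
  rw [result_eq_naming rfl]
  exact naming_mem_available ha (by omega) (by omega)

end Run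

/-! ### Reconstructing from observations what `s` would have named. -/

section Shadow

variable (s : (game own T typ v).Strategy i)

open Classical in
/-- The item named by a player who follows `s`, believing that she has so far named the items in
`w`, and keeps naming the last of them as long as it is available. -/
noncomputable def shadowMove : List (Typ i × Set O) → List O → O
  | o :: l, y :: w => if y ∈ o.2 then y else s.1 ⟨o :: l, y :: w⟩
  | l, w => s.1 ⟨l, w⟩

theorem shadowMove_of_mem {o : Typ i × Set O} {y : O} (hy : y ∈ o.2) (l : List (Typ i × Set O))
    (w : List O) : shadowMove s (o :: l) (y :: w) = y := if_pos hy

theorem shadowMove_of_not_mem {o : Typ i × Set O} {y : O} (hy : y ∉ o.2)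
    (l : List (Typ i × Set O)) (w : List O) :
    shadowMove s (o :: l) (y :: w) = s.1 ⟨o :: l, y :: w⟩ := if_neg hy

/-- The items that `s` would have named, given the observations made. -/
noncomputable def shadow : List (Typ i × Set O) → List O
  | [] => []
  -- Observations outnumber own moves by one: the newest observation precedes the next move and is
  -- dropped when past moves are computed.
  | [_] => []
  | _ :: o :: l => shadowMove s (o :: l) (shadow (o :: l)) :: shadow (o :: l)

/-- The item that `s` would name next, given the observations made. -/
noncomputable def shadowNext (l : List (Typ i × Set O)) : O := shadowMove s l (shadow s l)

theorem shadow_seen_succ (s' : (game own T typ v).Strategy i)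
    (c : (game own T typ v).Contingency i) (t : ℕ) :
    shadow s (infoAt s' c (t + 1)).seen =
      shadowNext s (infoAt s' c t).seen :: shadow s (infoAt s' c t).seen := by
  obtain ⟨l, hl⟩ := seen_infoAt s' c t
  rw [seen_infoAt_succ, hl]
  rfl

/-- On the path of `s` the repetition built into `shadowMove` is forced by the rules: a player whose
last named item is still available is not asked. -/
theorem shadowMove_infoAt (c : (game own T typ v).Contingency i) {t : ℕ} (ht : t < T) :
    shadowMove s (infoAt s c t).seen (infoAt s c t).own = naming s c t i := by
  have hs := naming_self s c t
  cases t with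
  | zero => rw [hs]; rfl
  | succ t =>
    have h1 := seen_infoAt_succ s c t
    have h2 := own_infoAt_succ s c t
    by_cases hy : naming s c t i ∈ available own (named s c (t + 1))
    · rw [h1, h2]
      refine (shadowMove_of_mem s (o := (typ i c.1, _)) hy _ _).trans ?_
      refine (eq_lastNamed_of_not_asked (fun ha => ?_) (naming_mem_menu s c ht i)).symm
      exact ha.2 hy
    · rw [h1, h2]
      refine (shadowMove_of_not_mem s (o := (typ i c.1, _)) hy _ _).trans ?_
      rw [hs]
      exact congrArg s.1 (info_path_succ s c t i).symm

theorem shadow_infoAt (c : (game own T typ v).Contingency i) {t : ℕ} (ht : t ≤ T) :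
    shadow s (infoAt s c t).seen = (infoAt s c t).own := by
  induction t with
  | zero => rfl
  | succ t ih =>
    rw [shadow_seen_succ, own_infoAt_succ, ← shadowMove_infoAt s c ht,
      ← ih (Nat.le_of_succ_le ht)]
    rfl

theorem shadowNext_infoAt (c : (game own T typ v).Contingency i) {t : ℕ} (ht : t < T) :
    shadowNext s (infoAt s c t).seen = naming s c t i := by
  rw [← shadowMove_infoAt s c ht, ← shadow_infoAt s c ht.le]
  rfl

theorem shadowNext_of_mem {l : List (Typ i × Set O)} {o : Typ i × Set O} {y : O} {w : List O}
    (hw : shadow s (o :: l) = y :: w) (hy : y ∈ o.2) : shadowNext s (o :: l) = y := by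
  change shadowMove s (o :: l) (shadow s (o :: l)) = y
  rw [hw, shadowMove_of_mem s hy]

open Classical in
/-- The strategy that names `a` at `h` and otherwise does what `s` would do, given the
observations made, whenever this is possible. -/
noncomputable def shadowStrategy (h : (game own T typ v).Info i) (a : O)
    (ha : a ∈ h.actions) : (game own T typ v).Strategy i :=
  -- The fallback `s.1 k` keeps the strategy legal where the shadow item is forbidden, for instance
  -- while `i` has to repeat `a`.
  ⟨fun k => if k = h then a else if shadowNext s k.seen ∈ k.actions then shadowNext s k.seen
      else s.1 k, by
    intro k hk
    exact iteInduction (motive := (· ∈ k.actions)) (fun h1 => h1 ▸ ha)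
      fun _ => iteInduction (motive := (· ∈ k.actions)) (fun h2 => h2) fun _ => s.2 k hk⟩

variable {s} {h : (game own T typ v).Info i} {a b : O} (ha : a ∈ h.actions)
  {c : (game own T typ v).Contingency i}

open Classical in
theorem shadowStrategy_mem_plans (hs : s ∈ plans h b) : shadowStrategy s h a ha ∈ plans h a := by
  obtain ⟨⟨c, hc⟩, -⟩ := hs
  obtain ⟨hT, hh⟩ := hc.infoAt_time
  refine ⟨⟨c, h.time, hT, ?_⟩, if_pos rfl⟩
  -- Before `h` the observations are those of `s` itself, so the shadow item and the fallback are
  -- both its move.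
  have hp : path s c h.time = path (shadowStrategy s h a ha) c h.time := by
    refine path_congr fun k hk _ => ?_
    have hne : infoAt s c k ≠ h := by
      intro he
      have := time_infoAt s c k
      rw [he] at this
      omega
    have hn := shadowNext_infoAt s c (hk.trans hT)
    rw [naming_self] at hn
    symm
    refine (if_neg hne).trans ?_
    exact iteInduction (motive := (· = s.1 (infoAt s c k))) (fun _ => hn) fun _ => rfl
  rw [infoAt, ← hp]
  exact hh

theorem naming_shadowStrategy {t : ℕ} (hlt : h.time < t) (ht : t < T)
    (hm : shadowNext s (infoAt (shadowStrategy s h a ha) c t).seen ∈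
      menu own i (named (shadowStrategy s h a ha) c t)) :
    naming (shadowStrategy s h a ha) c t i =
      shadowNext s (infoAt (shadowStrategy s h a ha) c t).seen := by
  have hne : infoAt (shadowStrategy s h a ha) c t ≠ h := by
    intro he
    have := time_infoAt (shadowStrategy s h a ha) c t
    rw [he] at this
    omega
  have hact : shadowNext s (infoAt (shadowStrategy s h a ha) c t).seen ∈
      (infoAt (shadowStrategy s h a ha) c t).actions :=
    ⟨_, nonTerminal_path _ c ht, rfl, hm⟩
  rw [naming_self]
  exact (if_neg hne).trans (if_pos hact)

/-! ### Comparing the run of `s` with that of its shadow. -/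

/-- After `t` stages, the opponents have the same information under `s` and `s'`, and `i` has made
the same observations. -/
structure SameView (s s' : (game own T typ v).Strategy i) (c : (game own T typ v).Contingency i)
    (t : ℕ) : Prop where
  info_eq : ∀ j ≠ i, (game own T typ v).info j (path s c t) =
    (game own T typ v).info j (path s' c t)
  seen_eq : (infoAt s c t).seen = (infoAt s' c t).seen

theorem SameView.available_eq {s' : (game own T typ v).Strategy i} {t : ℕ}
    (hv : SameView s s' c t) : available own (named s c t) = available own (named s' c t) := by
  obtain ⟨l, hl⟩ := seen_infoAt s c t
  obtain ⟨l', hl'⟩ := seen_infoAt s' c t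
  have := hv.seen_eq
  rw [hl, hl'] at this
  exact congrArg Prod.snd (List.cons.inj this).1

theorem SameView.naming_eq {s' : (game own T typ v).Strategy i} {t : ℕ}
    (hv : SameView s s' c t) {j : I} (hj : j ≠ i) : naming s c t j = naming s' c t j := by
  have h1 := moves_of_ne s c t hj
  have h2 := moves_of_ne s' c t hj
  rw [hv.info_eq j hj, ← h2] at h1
  exact h1

/-- The names called by others are not observed, so a difference in the moves of `i` can reach the
opponents only through the set of available items. -/
theorem SameView.succ {s' : (game own T typ v).Strategy i} {t : ℕ} (hv : SameView s s' c t)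
    (ha : available own (named s c (t + 1)) = available own (named s' c (t + 1))) :
    SameView s s' c (t + 1) := by
  constructor
  · intro j hj
    have hm : moves s c t j = moves s' c t j := hv.naming_eq hj
    have ho : (game own T typ v).obs j (path s c (t + 1)) =
        (game own T typ v).obs j (path s' c (t + 1)) := congrArg (Prod.mk (typ j c.1)) ha
    rw [info_path_succ, info_path_succ, hv.info_eq j hj, hm, ho]
  · rw [seen_infoAt_succ, seen_infoAt_succ, hv.seen_eq, ha]

theorem SameView.of_path_eq {s' : (game own T typ v).Strategy i} {t : ℕ}
    (h : path s c t = path s' c t) : SameView s s' c t :=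
  ⟨fun j _ => by rw [h], by rw [infoAt, infoAt, h]⟩

/-- Player `i` has left with `y` under `s`, while under `s'` the owner of `y` points to her through
a chain and `y` is the last item that `s` would have named. -/
structure Secured (s s' : (game own T typ v).Strategy i) (c : (game own T typ v).Contingency i)
    (t : ℕ) (y : O) : Prop where
  hasLeft : HasLeft own i (named s c (t + 1))
  lastNamed_eq : lastNamed own i (named s c (t + 1)) = y
  chain : ReflTransGen (Points own (naming s' c t)) (own.symm y) i
  shadow_eq : shadowNext s (infoAt s' c t).seen = y

theorem Secured.mem_available {s' : (game own T typ v).Strategy i} {t : ℕ} {y : O}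
    (hS : Secured s s' c t y) (hl : ¬ HasLeft own i (named s' c (t + 1))) :
    y ∈ available own (named s' c (t + 1)) :=
  mem_available_of_reflTransGen hl hS.chain

theorem Secured.shadowNext_succ {s' : (game own T typ v).Strategy i} {t : ℕ} {y : O}
    (hS : Secured s s' c t y) (hl : ¬ HasLeft own i (named s' c (t + 1))) :
    shadowNext s (infoAt s' c (t + 1)).seen = y := by
  have h1 := shadow_seen_succ s s' c t
  rw [seen_infoAt_succ] at h1 ⊢
  rw [hS.shadow_eq] at h1
  exact shadowNext_of_mem s h1 (hS.mem_available hl)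

theorem Secured.succ {s' : (game own T typ v).Strategy i} {t : ℕ} {y : O} (ht : t + 1 < T)
    (hS : Secured s s' c t y) (hl : ¬ HasLeft own i (named s' c (t + 1))) :
    Secured s s' c (t + 1) y where
  hasLeft := hasLeft_named_mono (Nat.le_succ _) ht hS.hasLeft
  lastNamed_eq := (naming_of_hasLeft hS.hasLeft le_rfl ht).trans hS.lastNamed_eq
  chain := reflTransGen_cons hl (naming_mem_menu s' c ht) hS.chain
  shadow_eq := hS.shadowNext_succ hl

/-- Until `i` is asked again under `s'`, either `s` and `s'` look alike to everybody, or `i` has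
left under `s` with an item that she can still get under `s'`. -/
theorem sameView_or_secured {s' : (game own T typ v).Strategy i} {t₁ t : ℕ}
    (hv : SameView s s' c t₁) (hlt : t₁ < t) (ht : t ≤ T)
    (hl : ¬ HasLeft own i (named s' c t)) :
    (SameView s s' c t ∧ ¬ HasLeft own i (named s c t)) ∨
      ∃ u y, t = u + 1 ∧ Secured s s' c u y := by
  have step : ∀ u, u < T → ¬ HasLeft own i (named s' c (u + 1)) → SameView s s' c u →
      ((SameView s s' c (u + 1) ∧ ¬ HasLeft own i (named s c (u + 1))) ∨
        ∃ w y, u + 1 = w + 1 ∧ Secured s s' c w y) := by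
    intro u hu hlu hvu
    by_cases hL : HasLeft own i (named s c (u + 1))
    · refine .inr ⟨u, naming s c u i, rfl, hL, rfl, ?_, ?_⟩
      -- The chain that lets `i` leave under `s` consists of moves of opponents, who name the same
      -- items under `s'`.
      · refine reflTransGen_congr (fun k _ hk => (hvu.naming_eq hk).symm) ?_
        exact (hasLeft_cons_iff_reflTransGen i _ (named s c u)).1 hL
      · rw [← hvu.seen_eq, shadowNext_infoAt s c hu]
    · exact .inl ⟨hvu.succ (available_congr (fun j hj => hvu.naming_eq hj) hL hlu), hL⟩
  have hlt' : t₁ + 1 ≤ t := hlt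
  induction t, hlt' using Nat.le_induction with
  | base => exact step _ ht hl hv
  | succ u htu ih =>
    have hl' : ¬ HasLeft own i (named s' c u) :=
      fun h => hl (hasLeft_named_mono u.le_succ ht h)
    rcases ih htu (Nat.le_of_succ_le ht) hl' with ⟨hvu, -⟩ | ⟨w, y, rfl, hS⟩
    · exact step u ht hl hvu
    · exact .inr ⟨_, y, rfl, hS.succ ht hl'⟩

theorem menu_congr {p : I → O} {m m' : List (I → O)}
    (h : available own (p :: m) = available own (p :: m')) :
    menu own i (p :: m) = menu own i (p :: m') := by
  simp only [menu, asked_cons_iff, h, lastNamed]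

/-- Outside `ending h a`, from the first active information set of the shadow strategy onwards,
that strategy names the same items as `s`. -/
theorem naming_shadowStrategy_eq (hs : s ∈ plans h b) (hc : c ∈ contingencies h)
    {t₀ t : ℕ} (h0 : h.time < t₀) (ht₀ : t₀ ≤ t) (ht : t < T)
    (hask : Asked own i (named (shadowStrategy s h a ha) c t₀)) :
    naming (shadowStrategy s h a ha) c t i = naming s c t i := by
  have hs' := shadowStrategy_mem_plans ha hs
  set s' := shadowStrategy s h a ha
  have hl : ¬ HasLeft own i (named s' c t₀) := fun h => h.not_asked hask
  have hT₀ : t₀ < T := ht₀.trans_lt ht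
  rcases sameView_or_secured (SameView.of_path_eq (path_time_eq hs hs' hc))
    h0 hT₀.le hl with ⟨hv, hL⟩ | ⟨u, y, rfl, hS⟩
  · have first : naming s' c t₀ i = naming s c t₀ i := by
      have hn : shadowNext s (infoAt s' c t₀).seen = naming s c t₀ i := by
        rw [← hv.seen_eq, shadowNext_infoAt s c hT₀]
      rw [← hn]
      refine naming_shadowStrategy ha h0 hT₀ (.inl ⟨hask, ?_⟩)
      rw [hn, ← hv.available_eq]
      exact mem_available_of_mem_menu hL (naming_mem_menu s c hT₀ i)
    -- From here on `i` may leave, so `available_congr` no longer applies; instead the whole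
    -- profiles coincide, hence so do their cycles.
    have next : ∀ u, SameView s s' c u → naming s' c u i = naming s c u i →
        naming s' c u = naming s c u ∧ SameView s s' c (u + 1) := by
      intro u hvu hi
      have hn : naming s' c u = naming s c u := by
        funext j
        by_cases hj : j = i
        · rw [hj, hi]
        · exact (hvu.naming_eq hj).symm
      refine ⟨hn, hvu.succ ?_⟩
      rw [named_succ, named_succ, hn]
      ext x
      simp only [mem_available_iff, hasLeft_iff]
    suffices SameView s s' c t ∧ naming s' c t i = naming s c t i from this.2
    induction t, ht₀ using Nat.le_induction with
    | base => exact ⟨hv, first⟩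
    | succ u htu ih =>
      obtain ⟨hvu, hi⟩ := ih (Nat.lt_of_succ_lt ht)
      obtain ⟨hn, hv'⟩ := next u hvu hi
      refine ⟨hv', ?_⟩
      have hsh : shadowNext s (infoAt s' c (u + 1)).seen = naming s c (u + 1) i := by
        rw [← hv'.seen_eq, shadowNext_infoAt s c ht]
      rw [← hsh]
      refine naming_shadowStrategy ha (h0.trans (Nat.lt_succ_of_le htu)) ht ?_
      have hm := naming_mem_menu s c ht i
      have hav := hv'.available_eq
      rw [named_succ, named_succ, hn] at hav
      rw [hsh, named_succ s' c, hn, ← menu_congr hav]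
      exact hm
  · have hsh := hS.shadowNext_succ hl
    have first : naming s' c (u + 1) i = y := by
      rw [← hsh]
      refine naming_shadowStrategy ha h0 hT₀ (.inl ⟨hask, ?_⟩)
      rw [hsh]
      exact hS.mem_available hl
    -- Naming `y` closes the surviving chain into a cycle, so `i` leaves at once and repeats `y`
    -- forever, as she does under `s`.
    have hleft : HasLeft own i (named s' c (u + 1 + 1)) := by
      refine (hasLeft_cons_iff_reflTransGen i (naming s' c (u + 1)) _).2 ?_
      rw [first]
      exact reflTransGen_cons hl (naming_mem_menu s' c hT₀) hS.chain
    rw [naming_of_hasLeft hS.hasLeft ht₀ ht, hS.lastNamed_eq]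
    rcases ht₀.eq_or_lt with rfl | hlt
    · exact first
    · rw [naming_of_hasLeft hleft hlt ht]
      exact first

end Shadow

end TTC

/-! ### The four cells of the ending partition. -/

theorem proposition3 {I O Θ : Type*} [Fintype I] (own : I ≃ O) {Typ : I → Type*}
    (typ : ∀ i, Θ → Typ i) (v : ∀ i, Typ i → O → ℝ)
    (hv : ∀ i τ, Function.Injective (v i τ))
    (T : ℕ) (hT : Fintype.card I ≤ T)
    (i : I) (θ : Θ) (m : List (I → O))
    (hx : (TTC.game own T typ v).NonTerminal (θ, m))
    (hact : (TTC.game own T typ v).info i (θ, m) ∈ (TTC.game own T typ v).activeSets i)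
    (a : O) (ha : a ∈ TTC.available own m)
    (hfav : ∀ b ∈ TTC.available own m, v i (typ i θ) b ≤ v i (typ i θ) a) :
    MultistageGame.LocallyEndDominant (G := TTC.game own T typ v)
      ((TTC.game own T typ v).info i (θ, m)) a := by
  open MultistageGame TTC in
  set h := (TTC.game own T typ v).info i (θ, m)
  have hask : Asked own i m := by
    obtain ⟨x, -, hxi, hxa⟩ := hact
    exact (avail_congr hxi).2.1 hxa
  have hah : a ∈ h.actions := ⟨(θ, m), hx, rfl, Or.inl ⟨hask, ha⟩⟩
  -- The type, the available items and being asked can be read off `h`, so payoffs are comparable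
  -- across different contingencies.
  have hreach : ∀ (b : O), ∀ s ∈ plans h b, ∀ c ∈ contingencies h,
      typ i c.1 = typ i θ ∧ available own (named s c h.time) = available own m ∧
        Asked own i (named s c h.time) := by
    intro b s hs c hc
    have hi : (TTC.game own T typ v).info i (path s c h.time) =
      (TTC.game own T typ v).info i (θ, m) := (infoAt_time_of_mem hs hc).2
    have ho : (typ i c.1, available own (named s c h.time)) = (typ i θ, available own m) :=
      obs_eq_of_info_eq hi
    exact ⟨congrArg Prod.fst ho, congrArg Prod.snd ho, (avail_congr hi).2.2 hask⟩
  refine ⟨hah, fun b _ _ S hS hrel s hs => ?_⟩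
  have hs' := shadowStrategy_mem_plans hah hs
  have best : S ⊆ ending h a → ∃ s' ∈ plans h a, Mimics s' s h S ∧
      ∀ c' ∈ S, ∀ c ∈ S, payoff s c ≤ payoff s' c' := by
    intro hSa
    -- Mimicking is vacuous here: no active information set follows `h` after `a`.
    refine ⟨_, hs', fun c hc t₀ t h0 h1 h2 hac =>
      absurd hac ((hSa hc).2 _ hs' t₀ h0 (h1.trans_lt h2)), fun c' hc' c hc => ?_⟩
    obtain ⟨ht, hav, ha'⟩ := hreach b s hs c (hSa hc).1
    have hr := result_mem_available hs (hSa hc).1 ha'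
    rw [hav] at hr
    have h1 : payoff s c = v i (typ i θ) (result s c) := by rw [← ht]; rfl
    have h2 : payoff (shadowStrategy s h a hah) c' = v i (typ i θ) a := by
      rw [← (hreach a _ hs' c' (hSa hc').1).1]
      exact congrArg (v i (typ i c'.1)) (result_of_mem_ending hs' (hSa hc'))
    rw [h1, h2]
    exact hfav _ hr
  have irrel : (∀ c ∈ S, c ∈ contingencies h ∧ c ∉ ending h a) → Irrelevant h a b S := by
    intro hSa r hr
    have hr' := shadowStrategy_mem_plans hah hr
    refine ⟨_, hr', fun c hc t₀ t h0 h1 h2 hac => ?_, fun c hc => ?_⟩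
    · have := naming_shadowStrategy_eq hah hr (hSa c hc).1
        h0 h1 h2 ((infoAt_mem_activeSets_iff_asked _ c (h1.trans_lt h2)).1 hac)
      rwa [naming_self, naming_self] at this
    · obtain ⟨t₀, h0, h1, h2⟩ := exists_active_of_not_mem_ending hr' (hSa c hc).1 (hSa c hc).2
      have h1' : t₀ < T := h1
      obtain ⟨n, rfl⟩ : ∃ n, T = n + 1 := ⟨T - 1, by omega⟩
      -- The outcome is the item named at the last stage, and the two plans agree from the active
      -- stage `t₀` up to that one.
      rw [result_eq_naming rfl, result_eq_naming rfl]
      exact naming_shadowStrategy_eq hah hr (hSa c hc).1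
        h0 (Nat.le_of_lt_succ h1') n.lt_succ_self h2
  -- Only membership in `ending h a` matters: the first and third cells lie inside it, the second
  -- and fourth outside.
  rcases hS with rfl | rfl | rfl | rfl
  · exact best fun c hc => hc.2
  · exact absurd (irrel fun c hc => ⟨hc.1.1, hc.2⟩) hrel
  · exact best fun c hc => hc.1
  · exact absurd (irrel fun c hc => ⟨hc.1, fun h => hc.2 (.inl h)⟩) hrel
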